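/- A Markov decision process (MDP) $\mathcal M=(V,A,\theta,\mu,w)$ consists of a finite set $V$ of $n=|V|$ vertices, a finite nonempty set $A$ of actions, a probability distribution $\theta(v,a)$ on $V$ for all $v\in V$, $a\in A$, an initial probability distribution $\mu$ on $V$, and weights $w:V\to\mathbb R$. A strategy is a function $\sigma$ that maps every nonempty finite sequence of vertices to a probability distribution on $A$. The probability of a finite path under $\sigma$ is $$\mathbb P_\mu^\sigma(v_0v_1\cdots v_k)=\mu(v_0)\cdot\prod_{i=0}^{k-1}\sum_{a\in A}\sigma(v_0\cdots v_i)(a)\cdot\theta(v_i,a)(v_{i+1}),$$ and $\mathbb E_\mu^\sigma$ denotes the corresponding expectation. The optimal mean-payoff value of $\mathcal M$ is $$\mathrm{val}^{\mathrm{MP}}(\mathcal M)=\sup_\sigma\,\limsup_{t\to\infty}\frac1t\sum_{i=0}^{t-1}\mathbb E_\mu^\sigma(w(v_i)).$$ Let $\alpha=\min\{\theta(v,a)(v') : v,v'\in V,\ a\in A,\ \theta(v,a)(v')>0\}$ be the smallest positive transition probability and $W=\max_{v\in V}|w(v)|$ the largest absolute weight. Theorem. There exist absolute constants $C\in\mathbb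 R$ and $c\in\mathbb N$ such that for every MDP $\mathcal M$ with $n$ vertices and $\mathrm{val}^{\mathrm{MP}}(\mathcal M)\le 0$, $$\sup_\sigma\,\sup_{t\in\mathbb N}\ \sum_{i=0}^{t}\mathbb E_\mu^\sigma(w(v_i))\ \le\ C\cdot n^{16}\cdot W\cdot\left(\frac1\alpha\right)^{c\,n^3}.$$ -/

import Mathlib

open Filter

noncomputable section

/-- A Markov decision process with (finite) vertex set `V` and (finite) action set `A`. -/
structure MDP (V A : Type*) [Fintype V] where
  /-- `θ v a v'` is the probability to move from `v` to `v'` when action `a` is played. -/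
  θ : V → A → V → ℝ
  θ_nonneg : ∀ v a v', 0 ≤ θ v a v'
  θ_sum : ∀ v a, ∑ v', θ v a v' = 1
  /-- the initial distribution -/
  μ : V → ℝ
  μ_nonneg : ∀ v, 0 ≤ μ v
  μ_sum : ∑ v, μ v = 1
  /-- the weights (rewards) of the vertices -/
  w : V → ℝ

/-- A (randomized, history-dependent) strategy: it maps every nonempty sequence
`v₀ … vₖ` of vertices, given as `ρ : Fin (k + 1) → V`, to a probability distribution on actions. -/
structure Strategy (V A : Type*) [Fintype A] where
  act : (k : ℕ) → (Fin (k + 1) → V) → A → ℝ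
  act_nonneg : ∀ k ρ a, 0 ≤ act k ρ a
  act_sum : ∀ k ρ, ∑ a, act k ρ a = 1

namespace MDP

variable {V A : Type*} [Fintype V] [Fintype A]

/-- The probability of the finite path `v₀ … vₖ` under the strategy `σ`:
`μ(v₀) · ∏_{i < k} ∑_a σ(v₀ … vᵢ)(a) · θ(vᵢ, a)(vᵢ₊₁)`. -/
def pathProb (M : MDP V A) (σ : Strategy V A) (k : ℕ) (ρ : Fin (k + 1) → V) : ℝ :=
  M.μ (ρ 0) * ∏ i : Fin k, ∑ a : A,
    σ.act i (fun j : Fin (i + 1) => ρ (Fin.castLE (by omega) j)) a *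
      M.θ (ρ i.castSucc) a (ρ i.succ)

/-- The expected value of a function `f` of the first `k + 1` vertices `v₀ … vₖ`. -/
def expectation (M : MDP V A) (σ : Strategy V A) (k : ℕ) (f : (Fin (k + 1) → V) → ℝ) : ℝ :=
  ∑ ρ : Fin (k + 1) → V, M.pathProb σ k ρ * f ρ

/-- The expected weight `E(w(vᵢ))` collected at step `i`. -/
def expectedWeight (M : MDP V A) (σ : Strategy V A) (i : ℕ) : ℝ :=
  M.expectation σ i (fun ρ => M.w (ρ (Fin.last i)))

/-- The expected total reward `∑_{i=0}^{t} E(w(vᵢ))`. -/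
def totalReward (M : MDP V A) (σ : Strategy V A) (t : ℕ) : ℝ :=
  ∑ i ∈ Finset.range (t + 1), M.expectedWeight σ i

/-- The mean-payoff expected reward `limsup_{t → ∞} (1/t) ∑_{i=0}^{t-1} E(w(vᵢ))` of `σ`. -/
def meanPayoff (M : MDP V A) (σ : Strategy V A) : EReal :=
  limsup (fun t : ℕ => ((1 / (t : ℝ) * ∑ i ∈ Finset.range t, M.expectedWeight σ i : ℝ) : EReal))
    atTop

/-- The optimal mean-payoff value: supremum over all strategies. -/
def optMeanPayoff (M : MDP V A) : EReal :=
  ⨆ σ : Strategy V A, M.meanPayoff σ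

/-- The supremum, over strategies and times, of the expected total reward. -/
def supTotalReward (M : MDP V A) : EReal :=
  ⨆ σ : Strategy V A, ⨆ t : ℕ, ((M.totalReward σ t : ℝ) : EReal)

/-- The smallest positive transition probability. -/
def minProb (M : MDP V A) : ℝ :=
  sInf {p : ℝ | 0 < p ∧ ∃ v a v', M.θ v a v' = p}

/-- The infimum in `minProb` is attained: it is a minimum. -/
theorem minProb_isLeast [Nonempty A] (M : MDP V A) :
    IsLeast {p : ℝ | 0 < p ∧ ∃ v a v', M.θ v a v' = p} M.minProb := by
  have hfin : {p : ℝ | 0 < p ∧ ∃ v a v', M.θ v a v' = p}.Finite := by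
    refine (Set.finite_range (fun x : V × A × V => M.θ x.1 x.2.1 x.2.2)).subset ?_
    rintro p ⟨-, v, a, v', rfl⟩
    exact ⟨(v, a, v'), rfl⟩
  have hne : {p : ℝ | 0 < p ∧ ∃ v a v', M.θ v a v' = p}.Nonempty := by
    have hV : ∃ v, M.μ v ≠ 0 := by
      by_contra! h
      have := M.μ_sum
      simp [h] at this
    obtain ⟨v, -⟩ := hV
    obtain ⟨a⟩ := ‹Nonempty A›
    have hv : ∃ v', M.θ v a v' ≠ 0 := by
      by_contra! h
      have := M.θ_sum v a
      simp [h] at this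
    obtain ⟨v', hv'⟩ := hv
    exact ⟨_, lt_of_le_of_ne (M.θ_nonneg v a v') hv'.symm, v, a, v', rfl⟩
  exact ⟨hne.csInf_mem hfin, fun p hp => csInf_le hfin.bddBelow hp⟩

/-- The largest absolute weight. -/
def maxWeight (M : MDP V A) : ℝ :=
  sSup {x : ℝ | ∃ v, |M.w v| = x}
/-- The supremum in `maxWeight` is attained: it is a maximum. -/
theorem maxWeight_isGreatest {V B : Type*} [Fintype V] (M : MDP V B) :
    IsGreatest {x : ℝ | ∃ v, |M.w v| = x} M.maxWeight := by
  have hfin : {x : ℝ | ∃ v, |M.w v| = x}.Finite := Set.finite_range (fun v => |M.w v|)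
  have hne : {x : ℝ | ∃ v, |M.w v| = x}.Nonempty := by
    have hV : ∃ v, M.μ v ≠ 0 := by
      by_contra! h
      have := M.μ_sum
      simp [h] at this
    obtain ⟨v, -⟩ := hV
    exact ⟨_, v, rfl⟩
  exact ⟨hne.csSup_mem hfin, fun x hx => le_csSup hfin.bddAbove hx⟩

end MDP

end

/-!
The total reward is bounded by a supermartingale argument with an explicit potential.

The gain `g` is a limit of the normalised discounted values `lam * x` as `lam → 0`, taken along
discount factors that share one optimal positional policy `s` (`MDP.IsGain`,
`MDP.exists_isGain`). Passing to the limit in the optimality equation, `g` does not increase in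
expectation under any action and is preserved by `s`, so that `s` has mean payoff at least the
average of `g` over the initial distribution; this average is therefore nonpositive
(`MDP.IsGain.sum_nonpos`). It remains to bound the expected total surplus of `w` over `g` by a
constant that depends only on `W`, `α` and `n`, and there are two sources of surplus.

* Actions that stay inside a level set of `g`. Their optimal discounted surplus, with the option
  to stop, is at most `2 W n α⁻ⁿ` (`MDP.IsGain.exists_internal_potential`). Otherwise there would
  be a set of vertices closed under the optimal policy on which this surplus is positive, and
  staying there forever would yield more than `g` (`MDP.IsGain.not_surplus`).
* Actions that may leave the level set of `g`. Since `g` does not increase in expectation, each of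
  them moves to a strictly lower level with probability at least `α`, and there are at most `n`
  levels. So they are played at most `n α⁻ⁿ` times in expectation
  (`MDP.IsGain.exists_level_potential`).

A combination of the two potentials bounds the total reward
(`MDP.totalReward_le_of_potential`, `MDP.totalReward_le`), in fact by `8 W n² α⁻²ⁿ`.
-/

/-! ### Discounted optimality equations -/

/-- A discounted optimality equation over finitely many options has a solution: its right-hand
side is a contraction for the supremum norm. -/
theorem exists_discounted_fixedPoint {V I : Type*} [Fintype V] [Fintype I] [Nonempty I]
    (r : V → I → ℝ) (q : V → I → V → ℝ) (hq : ∀ v i v', 0 ≤ q v i v') {β : ℝ} (hβ0 : 0 ≤ β)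
    (hβ1 : β < 1) (hsum : ∀ v i, ∑ v', q v i v' ≤ β) :
    ∃ x : V → ℝ, (∀ v i, r v i + ∑ v', q v i v' * x v' ≤ x v) ∧
      ∀ v, ∃ i, x v = r v i + ∑ v', q v i v' * x v' := by
  set T : (V → ℝ) → V → ℝ := fun x v =>
    Finset.univ.sup' Finset.univ_nonempty (fun i : I => r v i + ∑ v', q v i v' * x v') with hT
  have hle : ∀ x y : V → ℝ, ∀ v, T x v ≤ T y v + β * dist x y := by
    intro x y v
    refine Finset.sup'_le _ _ fun i _ => ?_
    have h1 : r v i + ∑ v', q v i v' * y v' ≤ T y v :=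
      Finset.le_sup' (fun i : I => r v i + ∑ v', q v i v' * y v') (Finset.mem_univ i)
    have h2 : ∑ v', q v i v' * x v' ≤ ∑ v', (q v i v' * y v' + q v i v' * dist x y) := by
      refine Finset.sum_le_sum fun v' _ => ?_
      have := (abs_le.1 (Real.dist_eq (x v') (y v') ▸ dist_le_pi_dist x y v')).2
      nlinarith [hq v i v']
    rw [Finset.sum_add_distrib, ← Finset.sum_mul] at h2
    have := mul_le_mul_of_nonneg_right (hsum v i) (dist_nonneg (x := x) (y := y))
    linarith
  have hc : ContractingWith ⟨β, hβ0⟩ T := by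
    refine ⟨by exact_mod_cast hβ1, LipschitzWith.of_dist_le_mul fun x y => ?_⟩
    refine (dist_pi_le_iff (by positivity)).2 fun v => ?_
    have h1 := hle x y v
    have h2 := hle y x v
    rw [dist_comm y x] at h2
    rw [Real.dist_eq, abs_le]
    change -(β * dist x y) ≤ _ ∧ _ ≤ β * dist x y
    constructor <;> linarith
  have hfix : T (hc.fixedPoint T) = hc.fixedPoint T := hc.fixedPoint_isFixedPt
  refine ⟨hc.fixedPoint T, fun v i => ?_, fun v => ?_⟩
  · conv_rhs => rw [← hfix]
    exact Finset.le_sup' (fun i : I => r v i + ∑ v', q v i v' * (hc.fixedPoint T) v')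
      (Finset.mem_univ i)
  · obtain ⟨i, -, hi⟩ := Finset.exists_mem_eq_sup' Finset.univ_nonempty
      (fun i : I => r v i + ∑ v', q v i v' * (hc.fixedPoint T) v')
    exact ⟨i, by conv_lhs => rw [← hfix]
                 exact hi⟩

namespace MDP

variable {V A : Type*} [Fintype V]

/-! ### One-step expectations -/

/-- The expectation of `F` at the successor of `v` when action `a` is played. -/
noncomputable def nextVal (M : MDP V A) (F : V → ℝ) (v : V) (a : A) : ℝ :=
  ∑ v', M.θ v a v' * F v'

theorem nonempty_vertices (M : MDP V A) : Nonempty V := by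
  by_contra h
  rw [not_nonempty_iff] at h
  simpa using M.μ_sum

theorem nextVal_const (M : MDP V A) (c : ℝ) (v : V) (a : A) :
    M.nextVal (fun _ => c) v a = c := by
  simp [nextVal, ← Finset.sum_mul, M.θ_sum]

theorem nextVal_add (M : MDP V A) (F G : V → ℝ) (v : V) (a : A) :
    M.nextVal (fun u => F u + G u) v a = M.nextVal F v a + M.nextVal G v a := by
  simp [nextVal, mul_add, Finset.sum_add_distrib]

theorem nextVal_sub (M : MDP V A) (F G : V → ℝ) (v : V) (a : A) :
    M.nextVal (fun u => F u - G u) v a = M.nextVal F v a - M.nextVal G v a := by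
  simp [nextVal, mul_sub, Finset.sum_sub_distrib]

theorem nextVal_const_mul (M : MDP V A) (c : ℝ) (F : V → ℝ) (v : V) (a : A) :
    M.nextVal (fun u => c * F u) v a = c * M.nextVal F v a := by
  simp [nextVal, Finset.mul_sum, mul_left_comm]

theorem nextVal_mono (M : MDP V A) {F G : V → ℝ} {v : V} {a : A}
    (h : ∀ u, 0 < M.θ v a u → F u ≤ G u) : M.nextVal F v a ≤ M.nextVal G v a := by
  refine Finset.sum_le_sum fun u _ => ?_
  rcases (M.θ_nonneg v a u).eq_or_lt with h0 | h0
  · simp [← h0]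
  · exact mul_le_mul_of_nonneg_left (h u h0) h0.le

theorem nextVal_le (M : MDP V A) {F : V → ℝ} {v : V} {a : A} {c : ℝ}
    (h : ∀ u, 0 < M.θ v a u → F u ≤ c) : M.nextVal F v a ≤ c :=
  (M.nextVal_mono h).trans_eq (M.nextVal_const c v a)

theorem le_nextVal (M : MDP V A) {F : V → ℝ} {v : V} {a : A} {c : ℝ}
    (h : ∀ u, 0 < M.θ v a u → c ≤ F u) : c ≤ M.nextVal F v a :=
  (M.nextVal_const c v a).symm.le.trans (M.nextVal_mono h)

theorem nextVal_eq (M : MDP V A) {F : V → ℝ} {v : V} {a : A} {c : ℝ}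
    (h : ∀ u, 0 < M.θ v a u → F u = c) : M.nextVal F v a = c :=
  le_antisymm (M.nextVal_le fun u hu => (h u hu).le) (M.le_nextVal fun u hu => (h u hu).ge)

/-- A successor at which `F` lies below the bound `m` lowers the expectation in proportion to its
probability. -/
theorem nextVal_le_sub (M : MDP V A) {F : V → ℝ} {v : V} {a : A} {m : ℝ} (hm : ∀ u, F u ≤ m)
    (u : V) : M.nextVal F v a ≤ m - M.θ v a u * (m - F u) := by
  have h1 : m - M.nextVal F v a = ∑ u, M.θ v a u * (m - F u) := by
    conv_lhs => rw [← M.nextVal_const m v a]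
    simp [nextVal, mul_sub, Finset.sum_sub_distrib]
  have h2 : M.θ v a u * (m - F u) ≤ ∑ u, M.θ v a u * (m - F u) :=
    Finset.single_le_sum (f := fun u => M.θ v a u * (m - F u))
      (fun u _ => mul_nonneg (M.θ_nonneg v a u) (sub_nonneg.2 (hm u))) (Finset.mem_univ u)
  linarith

theorem abs_w_le (M : MDP V A) (v : V) : |M.w v| ≤ M.maxWeight :=
  M.maxWeight_isGreatest.2 ⟨v, rfl⟩

theorem maxWeight_nonneg (M : MDP V A) : 0 ≤ M.maxWeight := by
  obtain ⟨v⟩ := M.nonempty_vertices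
  exact (abs_nonneg _).trans (M.abs_w_le v)

theorem tendsto_nextVal (M : MDP V A) {ι : Type*} {l : Filter ι} {F : ι → V → ℝ} {G : V → ℝ}
    (h : Tendsto F l (nhds G)) (v : V) (a : A) :
    Tendsto (fun i => M.nextVal (F i) v a) l (nhds (M.nextVal G v a)) :=
  tendsto_finsetSum _ fun u _ => (tendsto_pi_nhds.1 h u).const_mul _

variable [Fintype A]

theorem minProb_pos [Nonempty A] (M : MDP V A) : 0 < M.minProb :=
  M.minProb_isLeast.1.1

theorem minProb_le [Nonempty A] (M : MDP V A) {v u : V} {a : A} (h : 0 < M.θ v a u) :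
    M.minProb ≤ M.θ v a u :=
  M.minProb_isLeast.2 ⟨h, v, a, u, rfl⟩

theorem minProb_le_one [Nonempty A] (M : MDP V A) : M.minProb ≤ 1 := by
  obtain ⟨v, a, u, h⟩ := M.minProb_isLeast.1.2
  rw [← h, ← M.θ_sum v a]
  exact Finset.single_le_sum (f := fun u => M.θ v a u) (fun u _ => M.θ_nonneg v a u)
    (Finset.mem_univ u)

/-! ### Expectations along the play -/

/-- The expectation of `F` at the `i`-th vertex of the play. -/
noncomputable def expVal (M : MDP V A) (σ : Strategy V A) (i : ℕ) (F : V → ℝ) : ℝ :=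
  M.expectation σ i fun ρ => F (ρ (Fin.last i))

theorem pathProb_nonneg (M : MDP V A) (σ : Strategy V A) (k : ℕ) (ρ : Fin (k + 1) → V) :
    0 ≤ M.pathProb σ k ρ :=
  mul_nonneg (M.μ_nonneg _) <| Finset.prod_nonneg fun _ _ => Finset.sum_nonneg fun _ _ =>
    mul_nonneg (σ.act_nonneg _ _ _) (M.θ_nonneg _ _ _)

theorem pathProb_snoc (M : MDP V A) (σ : Strategy V A) (k : ℕ) (ρ : Fin (k + 1) → V) (u : V) :
    M.pathProb σ (k + 1) (Fin.snoc (α := fun _ => V) ρ u) =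
      M.pathProb σ k ρ * ∑ a, σ.act k ρ a * M.θ (ρ (Fin.last k)) a u := by
  have h0 : (Fin.snoc (α := fun _ => V) ρ u : Fin (k + 2) → V) 0 = ρ 0 :=
    Fin.snoc_castSucc (α := fun _ => V) u ρ 0
  have hcast : ∀ j : Fin (k + 1),
      (Fin.snoc (α := fun _ => V) ρ u : Fin (k + 2) → V) j.castSucc = ρ j := fun j =>
    Fin.snoc_castSucc (α := fun _ => V) u ρ j
  have hpre : ∀ (i : ℕ) (_ : i ≤ k) (h : i + 1 ≤ k + 1 + 1) (h' : i + 1 ≤ k + 1)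
      (j : Fin (i + 1)),
      (Fin.snoc (α := fun _ => V) ρ u : Fin (k + 2) → V) (Fin.castLE h j) =
        ρ (Fin.castLE h' j) := fun _ _ _ h' j => hcast (Fin.castLE h' j)
  unfold pathProb
  rw [Fin.prod_univ_castSucc, h0, mul_assoc]
  congr 2
  · refine Finset.prod_congr rfl fun i _ => Finset.sum_congr rfl fun a _ => ?_
    rw [hcast, ← Fin.castSucc_succ, hcast]
    congr 2
    funext j
    exact hpre i (by omega) _ _ j
  · refine Finset.sum_congr rfl fun a _ => ?_
    rw [hcast, Fin.succ_last, Fin.snoc_last]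
    congr 2
    funext j
    exact hpre k le_rfl _ le_rfl j

theorem expVal_zero (M : MDP V A) (σ : Strategy V A) (F : V → ℝ) :
    M.expVal σ 0 F = ∑ v, M.μ v * F v := by
  unfold expVal expectation
  rw [← (Equiv.funUnique (Fin 1) V).symm.sum_comp]
  simp [pathProb]

theorem expVal_succ (M : MDP V A) (σ : Strategy V A) (k : ℕ) (F : V → ℝ) :
    M.expVal σ (k + 1) F =
      M.expectation σ k fun ρ => ∑ a, σ.act k ρ a * M.nextVal F (ρ (Fin.last k)) a := by
  unfold expVal expectation
  rw [← (Fin.snocEquiv fun _ : Fin (k + 2) => V).sum_comp, Fintype.sum_prod_type_right]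
  refine Finset.sum_congr rfl fun ρ _ => ?_
  have h : ∀ u, M.pathProb σ (k + 1) (Fin.snocEquiv (fun _ : Fin (k + 2) => V) (u, ρ)) *
      F (Fin.snocEquiv (fun _ : Fin (k + 2) => V) (u, ρ) (Fin.last (k + 1))) =
      (M.pathProb σ k ρ * ∑ a, σ.act k ρ a * M.θ (ρ (Fin.last k)) a u) * F u := fun u => by
    simp only [Fin.snocEquiv_apply, Fin.snoc_last]
    exact congrArg (· * F u) (M.pathProb_snoc σ k ρ u)
  simp only [h, nextVal, Finset.mul_sum, Finset.sum_mul]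
  rw [Finset.sum_comm]
  exact Finset.sum_congr rfl fun a _ => Finset.sum_congr rfl fun u _ => by ring

theorem expVal_add (M : MDP V A) (σ : Strategy V A) (i : ℕ) (F G : V → ℝ) :
    M.expVal σ i (fun v => F v + G v) = M.expVal σ i F + M.expVal σ i G := by
  simp [expVal, expectation, mul_add, Finset.sum_add_distrib]

theorem expVal_sub (M : MDP V A) (σ : Strategy V A) (i : ℕ) (F G : V → ℝ) :
    M.expVal σ i (fun v => F v - G v) = M.expVal σ i F - M.expVal σ i G := by
  simp [expVal, expectation, mul_sub, Finset.sum_sub_distrib]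

theorem expVal_mono (M : MDP V A) (σ : Strategy V A) (i : ℕ) {F G : V → ℝ} (h : ∀ v, F v ≤ G v) :
    M.expVal σ i F ≤ M.expVal σ i G :=
  Finset.sum_le_sum fun _ _ => mul_le_mul_of_nonneg_left (h _) (M.pathProb_nonneg _ _ _)

theorem expVal_succ_le (M : MDP V A) (σ : Strategy V A) (k : ℕ) {F G : V → ℝ}
    (h : ∀ v a, M.nextVal F v a ≤ G v) : M.expVal σ (k + 1) F ≤ M.expVal σ k G := by
  rw [expVal_succ]
  refine Finset.sum_le_sum fun ρ _ => mul_le_mul_of_nonneg_left ?_ (M.pathProb_nonneg _ _ _)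
  calc ∑ a, σ.act k ρ a * M.nextVal F (ρ (Fin.last k)) a
      ≤ ∑ a, σ.act k ρ a * G (ρ (Fin.last k)) :=
        Finset.sum_le_sum fun a _ => mul_le_mul_of_nonneg_left (h _ a) (σ.act_nonneg _ _ _)
    _ = G (ρ (Fin.last k)) := by rw [← Finset.sum_mul, σ.act_sum, one_mul]

theorem expVal_const (M : MDP V A) (σ : Strategy V A) (i : ℕ) (c : ℝ) :
    M.expVal σ i (fun _ => c) = c := by
  induction i with
  | zero => rw [expVal_zero, ← Finset.sum_mul, M.μ_sum, one_mul]
  | succ k ih =>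
    rw [expVal_succ]
    simp only [nextVal_const, ← Finset.sum_mul, σ.act_sum, one_mul]
    exact ih

open Classical in
/-- The strategy that always plays the action `s v` when the current vertex is `v`. -/
noncomputable def positional (s : V → A) : Strategy V A where
  act k ρ a := if a = s (ρ (Fin.last k)) then 1 else 0
  act_nonneg k ρ a := by split_ifs <;> norm_num
  act_sum k ρ := by simp

theorem expVal_positional_succ (M : MDP V A) (s : V → A) (k : ℕ) (F : V → ℝ) :
    M.expVal (positional s) (k + 1) F =
      M.expVal (positional s) k fun v => M.nextVal F v (s v) := by
  classical
  rw [expVal_succ]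
  simp [positional, expVal]

/-! ### The gain -/

/-- Discounted optimality equation of `M`, for the total reward discounted by `1 - lam`. The
normalised value `lam * x` is bounded by the weights. -/
theorem exists_discounted_value [Nonempty A] (M : MDP V A) {lam : ℝ} (h0 : 0 < lam)
    (h1 : lam < 1) :
    ∃ (x : V → ℝ) (s : V → A), (∀ v a, M.w v + (1 - lam) * M.nextVal x v a ≤ x v) ∧
      (∀ v, x v = M.w v + (1 - lam) * M.nextVal x v (s v)) ∧
      ∀ v, |lam * x v| ≤ M.maxWeight := by
  have := M.nonempty_vertices
  have hl : 0 ≤ 1 - lam := by linarith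
  obtain ⟨x, hx, hs⟩ := exists_discounted_fixedPoint (fun v (_ : A) => M.w v)
    (fun v a u => (1 - lam) * M.θ v a u)
    (fun v a u => mul_nonneg hl (M.θ_nonneg v a u)) hl (by linarith)
    (fun v a => by rw [← Finset.mul_sum, M.θ_sum, mul_one])
  have hnext : ∀ v a, ∑ u, (1 - lam) * M.θ v a u * x u = (1 - lam) * M.nextVal x v a := by
    intro v a
    simp [nextVal, Finset.mul_sum, mul_assoc]
  simp only [hnext] at hx hs
  choose s hs using hs
  refine ⟨x, s, hx, hs, fun v => abs_le.2 ⟨?_, ?_⟩⟩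
  · obtain ⟨m, hm⟩ := Finite.exists_min x
    have h2 := hs m
    have h3 : x m ≤ M.nextVal x m (s m) := M.le_nextVal fun u _ => hm u
    have h4 := (abs_le.1 (M.abs_w_le m)).1
    have h5 := mul_le_mul_of_nonneg_left h3 hl
    have h6 := mul_le_mul_of_nonneg_left (hm v) h0.le
    linarith
  · obtain ⟨m, hm⟩ := Finite.exists_max x
    have h2 := hs m
    have h3 : M.nextVal x m (s m) ≤ x m := M.nextVal_le fun u _ => hm u
    have h4 := (abs_le.1 (M.abs_w_le m)).2
    have h5 := mul_le_mul_of_nonneg_left h3 hl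
    have h6 := mul_le_mul_of_nonneg_left (hm v) h0.le
    linarith

/-- `M.IsGain g s` says that `g` is a limit of normalised discounted values, for discount factors
tending to `1`, along which the single positional policy `s` is optimal. -/
structure IsGain (M : MDP V A) (g : V → ℝ) (s : V → A) : Prop where
  abs_le : ∀ v, |g v| ≤ M.maxWeight
  nextVal_le : ∀ v a, M.nextVal g v a ≤ g v
  nextVal_eq : ∀ v, M.nextVal g v (s v) = g v
  approx : ∀ ε > 0, ∃ (lam : ℝ) (x : V → ℝ), 0 < lam ∧ lam < 1 ∧ lam ≤ ε ∧
    (∀ v a, M.w v + (1 - lam) * M.nextVal x v a ≤ x v) ∧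
    (∀ v, x v = M.w v + (1 - lam) * M.nextVal x v (s v)) ∧ ∀ v, |lam * x v - g v| ≤ ε

theorem exists_isGain [Nonempty A] (M : MDP V A) : ∃ g s, M.IsGain g s := by
  have hlam0 : ∀ k : ℕ, (0 : ℝ) < 1 / ((k : ℝ) + 2) := fun k => by positivity
  have hlam1 : ∀ k : ℕ, (1 : ℝ) / ((k : ℝ) + 2) < 1 := fun k => by
    rw [div_lt_one (by positivity)]
    linarith [(Nat.cast_nonneg k : (0 : ℝ) ≤ k)]
  have hlim : Tendsto (fun k : ℕ => (1 : ℝ) / ((k : ℝ) + 2)) atTop (nhds 0) := by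
    have := (tendsto_one_div_add_atTop_nhds_zero_nat (𝕜 := ℝ)).comp (tendsto_add_atTop_nat 1)
    refine this.congr fun k => ?_
    simp only [Function.comp_apply, Nat.cast_add, Nat.cast_one]
    ring
  choose x s hle heq hbd using fun k : ℕ => M.exists_discounted_value (hlam0 k) (hlam1 k)
  -- Some policy is optimal for infinitely many of the discount factors.
  obtain ⟨s₀, hs₀⟩ : ∃ s₀, ∃ᶠ k in atTop, s k = s₀ := by
    rw [← frequently_exists]
    exact Frequently.of_forall fun k => ⟨s k, rfl⟩
  obtain ⟨φ, hφ, hφs⟩ := extraction_of_frequently_atTop hs₀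
  obtain ⟨g, hg, ψ, hψ, hgψ⟩ := (isCompact_Icc (a := fun _ : V => -M.maxWeight)
    (b := fun _ => M.maxWeight)).tendsto_subseq
    (x := fun k v => 1 / ((φ k : ℝ) + 2) * x (φ k) v)
    (fun k => ⟨fun v => (_root_.abs_le.1 (hbd (φ k) v)).1,
      fun v => (_root_.abs_le.1 (hbd (φ k) v)).2⟩)
  set κ : ℕ → ℕ := fun k => φ (ψ k) with hκ
  have hκt : Tendsto κ atTop atTop := hφ.tendsto_atTop.comp hψ.tendsto_atTop
  have hlimκ : Tendsto (fun k => (1 : ℝ) / ((κ k : ℝ) + 2)) atTop (nhds 0) := hlim.comp hκt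
  have hgκ : Tendsto (fun k v => 1 / ((κ k : ℝ) + 2) * x (κ k) v) atTop (nhds g) := hgψ
  have hrhs : ∀ v a, Tendsto (fun k => 1 / ((κ k : ℝ) + 2) * M.w v + (1 - 1 / ((κ k : ℝ) + 2)) *
      M.nextVal (fun u => 1 / ((κ k : ℝ) + 2) * x (κ k) u) v a) atTop
      (nhds (M.nextVal g v a)) := by
    intro v a
    have := (hlimκ.mul_const (M.w v)).add
      ((hlimκ.const_sub 1).mul (M.tendsto_nextVal hgκ v a))
    simpa using this
  refine ⟨g, s₀, fun v => _root_.abs_le.2 ⟨hg.1 v, hg.2 v⟩, fun v a => ?_, fun v => ?_,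
    fun ε hε => ?_⟩
  · refine le_of_tendsto_of_tendsto' (hrhs v a) (tendsto_pi_nhds.1 hgκ v) fun k => ?_
    have := mul_le_mul_of_nonneg_left (hle (κ k) v a) (hlam0 (κ k)).le
    rw [nextVal_const_mul]
    linarith
  · refine tendsto_nhds_unique (hrhs v (s₀ v)) ((tendsto_pi_nhds.1 hgκ v).congr fun k => ?_)
    have := heq (κ k) v
    rw [show s (κ k) = s₀ from hφs (ψ k)] at this
    rw [nextVal_const_mul]
    conv_lhs => rw [this]
    ring
  · have h1 : ∀ᶠ k in atTop, (1 : ℝ) / ((κ k : ℝ) + 2) ≤ ε :=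
      (hlimκ.eventually (gt_mem_nhds hε)).mono fun k hk => le_of_lt hk
    have h2 : ∀ᶠ k in atTop, ∀ v, |1 / ((κ k : ℝ) + 2) * x (κ k) v - g v| ≤ ε := by
      refine eventually_all.2 fun v => ?_
      have := Metric.tendsto_nhds.1 (tendsto_pi_nhds.1 hgκ v) ε hε
      exact this.mono fun k hk => (Real.dist_eq _ _ ▸ hk).le
    obtain ⟨k, hk1, hk2⟩ := (h1.and h2).exists
    refine ⟨_, x (κ k), hlam0 _, hlam1 _, hk1, hle _, fun v => ?_, hk2⟩
    have := heq (κ k) v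
    rwa [show s (κ k) = s₀ from hφs (ψ k)] at this

/-- The policy of a gain `g` realises mean payoff `g`; hence `g` is nonpositive on average over the
initial distribution when the optimal mean payoff is. -/
theorem IsGain.sum_nonpos {M : MDP V A} {g : V → ℝ} {s : V → A} (hg : M.IsGain g s)
    (hM : M.optMeanPayoff ≤ 0) : ∑ v, M.μ v * g v ≤ 0 := by
  by_contra! hpos
  set η := (∑ v, M.μ v * g v) / 3 with hη
  have hη0 : 0 < η := by positivity
  obtain ⟨lam, x, hl0, hl1, -, -, hx, happ⟩ := hg.approx η hη0
  set E := M.expVal (positional s) with hE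
  have hEg : ∀ i, E i g = 3 * η := by
    intro i
    induction i with
    | zero => rw [hE, expVal_zero, hη]; ring
    | succ k ih =>
      rw [hE, expVal_positional_succ]
      simp only [hg.nextVal_eq]
      exact ih
  have hstep : ∀ i, E i x - E (i + 1) x + 2 * η ≤ E i M.w := by
    intro i
    have h1 : E i x - E (i + 1) x = E i (fun v => x v - M.nextVal x v (s v)) := by
      rw [hE, expVal_positional_succ, expVal_sub]
    have h2 : E (i + 1) (fun v => lam * x v) = E i (fun v => lam * M.nextVal x v (s v)) := by
      rw [hE, expVal_positional_succ]
      simp only [nextVal_const_mul]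
    have h3 : 2 * η ≤ E (i + 1) (fun v => lam * x v) := by
      have : E (i + 1) (fun v => g v - η) ≤ E (i + 1) (fun v => lam * x v) :=
        M.expVal_mono _ _ fun v => by linarith [(_root_.abs_le.1 (happ v)).1]
      rw [hE, expVal_sub, expVal_const, ← hE, hEg] at this
      linarith
    have h4 : E i (fun v => x v - M.nextVal x v (s v)) + E i (fun v => lam * M.nextVal x v (s v))
        = E i M.w := by
      rw [hE, ← expVal_add]
      congr 1
      funext v
      linarith [hx v]
    linarith
  have hsum : ∀ t : ℕ, E 0 x - E t x + t * (2 * η) ≤ ∑ i ∈ Finset.range t, E i M.w := by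
    intro t
    induction t with
    | zero => simp
    | succ t ih =>
      rw [Finset.sum_range_succ]
      push_cast
      linarith [hstep t]
  obtain ⟨B, hB⟩ : ∃ B, ∀ v, x v ≤ B := by
    have := M.nonempty_vertices
    obtain ⟨m, hm⟩ := Finite.exists_max x
    exact ⟨x m, hm⟩
  have hEB : ∀ t, E t x ≤ B := fun t =>
    (M.expVal_mono _ t hB).trans_eq (M.expVal_const _ t B)
  have hev : ∀ᶠ t : ℕ in atTop,
      (η : EReal) ≤ ((1 / (t : ℝ) * ∑ i ∈ Finset.range t,
        M.expectedWeight (positional s) i : ℝ) : EReal) := by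
    obtain ⟨N, hN⟩ := exists_nat_ge ((B - E 0 x) / η)
    filter_upwards [eventually_ge_atTop N, eventually_gt_atTop 0] with t ht ht0
    have ht0' : (0 : ℝ) < t := by exact_mod_cast ht0
    have h1 : B - E 0 x ≤ t * η := by
      rw [← div_le_iff₀ hη0]
      exact hN.trans (by exact_mod_cast ht)
    rw [EReal.coe_le_coe_iff, one_div, le_inv_mul_iff₀ ht0']
    have h2 := hsum t
    have h3 := hEB t
    change t * η ≤ ∑ i ∈ Finset.range t, E i M.w
    linarith
  have h1 : (η : EReal) ≤ M.meanPayoff (positional s) :=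
    le_limsup_of_frequently_le' hev.frequently
  have h2 : (η : EReal) ≤ 0 := (h1.trans (le_iSup M.meanPayoff _)).trans hM
  have h3 : η ≤ 0 := by exact_mod_cast h2
  linarith

/-! ### Bounded play inside the levels of the gain -/

/-- The recursion `s₀ = 0`, `sₖ₊₁ = (1 + sₖ) / α`. Its solution `sₖ` is the expected number of
independent trials of success probability `α` up to the first run of `k` successes. -/
noncomputable def thresholds (α : ℝ) : ℕ → ℝ
  | 0 => 0
  | k + 1 => (1 + thresholds α k) / α

theorem thresholds_nonneg {α : ℝ} (h0 : 0 < α) (k : ℕ) : 0 ≤ thresholds α k := by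
  induction k with
  | zero => exact le_rfl
  | succ k ih => rw [thresholds]; positivity

theorem thresholds_mono {α : ℝ} (h0 : 0 < α) (h1 : α ≤ 1) : Monotone (thresholds α) := by
  refine monotone_nat_of_le_succ fun k => ?_
  rw [thresholds, le_div_iff₀ h0]
  nlinarith [thresholds_nonneg h0 k]

theorem thresholds_le {α : ℝ} (h0 : 0 < α) (h1 : α ≤ 1) (k : ℕ) :
    thresholds α k ≤ k * (1 / α) ^ k := by
  have h2 : 1 ≤ 1 / α := by rwa [le_div_iff₀ h0, one_mul]
  induction k with
  | zero => simp [thresholds]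
  | succ k ih =>
    have h3 : 1 ≤ (1 / α) ^ k := one_le_pow₀ h2
    rw [thresholds, div_eq_mul_one_div, pow_succ, ← mul_assoc]
    refine mul_le_mul_of_nonneg_right ?_ (by positivity)
    push_cast
    linarith

/-- An action is internal at `v` for `g` if it preserves the value of `g` almost surely. -/
def Internal (M : MDP V A) (g : V → ℝ) (v : V) (a : A) : Prop :=
  ∀ u, 0 < M.θ v a u → g u = g v

omit [Fintype A] in
/-- No nonempty set of vertices can be closed under internal actions along which the surplus
`w - g` is positive on average. Here `h` certifies this surplus, `c` being its amount per step:
discounted play inside the set would be worth more than the gain allows. -/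
theorem IsGain.not_surplus {M : MDP V A} {g : V → ℝ} {s : V → A} (hg : M.IsGain g s)
    {D : Set V} (hD : D.Nonempty) {τ : V → A} {h : V → ℝ} {c S : ℝ} (hc : 0 < c)
    (h0 : ∀ v, 0 ≤ h v) (hS : ∀ v, h v ≤ S) (hint : ∀ v ∈ D, M.Internal g v (τ v))
    (hclosed : ∀ v ∈ D, ∀ u, 0 < M.θ v (τ v) u → u ∈ D)
    (hh : ∀ v ∈ D, h v + c ≤ M.w v - g v + M.nextVal h v (τ v)) : False := by
  have hS0 : 0 ≤ S := (h0 hD.some).trans (hS _)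
  obtain ⟨lam, x, hl0, hl1, hle, hx, -, happ⟩ :=
    hg.approx (c / (S + 2)) (by positivity)
  -- The difference between `x` and the value promised by `h` attains its minimum over `D`.
  set Y : V → ℝ := fun v => lam * x v - (g v + c) - lam * h v with hY
  obtain ⟨v, hvD, hv⟩ := Set.exists_min_image D Y (Set.toFinite D) hD
  have h1 : Y v ≤ M.nextVal Y v (τ v) :=
    M.le_nextVal fun u hu => hv u (hclosed v hvD u hu)
  have h2 : M.nextVal Y v (τ v) =
      lam * M.nextVal x v (τ v) - (g v + c) - lam * M.nextVal h v (τ v) := by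
    have hgv : M.nextVal (fun u => g u + c) v (τ v) = g v + c :=
      M.nextVal_eq fun u hu => by rw [hint v hvD u hu]
    rw [hY, nextVal_sub, nextVal_sub, nextVal_const_mul, nextVal_const_mul, hgv]
  have h3 := mul_le_mul_of_nonneg_left (hx v (τ v)) hl0.le
  have h4 := mul_le_mul_of_nonneg_left (hh v hvD) hl0.le
  have h5 : M.nextVal h v (τ v) ≤ S := M.nextVal_le fun u _ => hS u
  have h6 := (_root_.abs_le.1 (happ v)).2
  have h7 : Y v = lam * x v - (g v + c) - lam * h v := rfl
  have h8 := mul_le_mul_of_nonneg_left h1 (show 0 ≤ 1 - lam by linarith)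
  have h9 : lam * (lam * M.nextVal h v (τ v)) ≤ lam * (lam * S) := by gcongr
  have h10 : -(lam * S) ≤ Y v := by
    have : lam * (-(lam * S)) ≤ lam * Y v := by
      rw [h2] at h8
      linarith
    exact le_of_mul_le_mul_left this hl0
  have h11 : lam * S ≤ c / (S + 2) * S := by gcongr
  have h12 : c / (S + 2) * S + c / (S + 2) * 2 = c := by field_simp
  have h13 : 0 < c / (S + 2) := by positivity
  have h14 : 0 ≤ lam * h v := mul_nonneg hl0.le (h0 v)
  linarith

/-- The optimal discounted surplus `w - g` of internal play, with the option to stop at any time,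
is bounded independently of the discount factor. If it were large, then following the optimal
policy from a vertex where it is maximal one would either stay in a set of vertices where it is
positive, which is impossible, or reach vertices of slightly smaller surplus; each new vertex
costs one step of `thresholds`, and there are only `card V` vertices. -/
theorem IsGain.exists_internal_potential [Nonempty A] {M : MDP V A} {g : V → ℝ} {s : V → A}
    (hg : M.IsGain g s) {lam : ℝ} (hl0 : 0 < lam) (hl1 : lam < 1) :
    ∃ h : V → ℝ, (∀ v, 0 ≤ h v) ∧
      (∀ v, h v ≤ 2 * M.maxWeight * thresholds M.minProb (Fintype.card V)) ∧
      ∀ v a, M.Internal g v a → M.w v - g v + (1 - lam) * M.nextVal h v a ≤ h v := by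
  classical
  have := M.nonempty_vertices
  have hl : 0 ≤ 1 - lam := by linarith
  set W := M.maxWeight with hW
  set α := M.minProb with hα
  have hα0 : 0 < α := M.minProb_pos
  have hW0 : 0 ≤ W := M.maxWeight_nonneg
  have hwg : ∀ v, M.w v - g v ≤ 2 * W := fun v => by
    have h1 := (_root_.abs_le.1 (M.abs_w_le v)).2
    have h2 := (_root_.abs_le.1 (hg.abs_le v)).1
    linarith
  -- The option `none` stops; actions that are not internal are replaced by it.
  obtain ⟨h, hle, hex⟩ := exists_discounted_fixedPoint (I := Option A)
    (fun v o => o.elim 0 fun a => if M.Internal g v a then M.w v - g v else 0)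
    (fun v o u => o.elim 0 fun a => if M.Internal g v a then (1 - lam) * M.θ v a u else 0)
    (by
      rintro v (_ | a) u
      · exact le_rfl
      · dsimp only [Option.elim]
        split_ifs
        · exact mul_nonneg hl (M.θ_nonneg v a u)
        · exact le_rfl) hl (by linarith)
    (by
      rintro v (_ | a)
      · simpa using hl1.le
      · dsimp only [Option.elim]
        split_ifs
        · rw [← Finset.mul_sum, M.θ_sum, mul_one]
        · simpa using hl1.le)
  have h0 : ∀ v, 0 ≤ h v := fun v => by simpa using hle v none
  have hnext : ∀ v a, ∑ u, (1 - lam) * M.θ v a u * h u = (1 - lam) * M.nextVal h v a := by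
    intro v a
    simp [nextVal, Finset.mul_sum, mul_assoc]
  have hint : ∀ v a, M.Internal g v a →
      M.w v - g v + (1 - lam) * M.nextVal h v a ≤ h v := by
    intro v a ha
    have := hle v (some a)
    simpa only [Option.elim, if_pos ha, hnext] using this
  have hpos : ∀ v, ∃ a, 0 < h v →
      M.Internal g v a ∧ h v = M.w v - g v + (1 - lam) * M.nextVal h v a := by
    intro v
    by_cases hv : 0 < h v
    · obtain ⟨o, ho⟩ := hex v
      rcases o with _ | a
      · simp at ho
        exact absurd ho hv.ne'
      · by_cases ha : M.Internal g v a
        · refine ⟨a, fun _ => ⟨ha, ?_⟩⟩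
          simpa only [Option.elim, if_pos ha, hnext] using ho
        · simp [ha] at ho
          exact absurd ho hv.ne'
    · exact ⟨Classical.arbitrary A, fun h' => absurd h' hv⟩
  choose τ hτ using hpos
  refine ⟨h, h0, ?_, hint⟩
  obtain ⟨m, hm⟩ := Finite.exists_max h
  by_contra! hbig
  obtain ⟨v₁, hv₁⟩ := hbig
  have hmbig := hv₁.trans_le (hm v₁)
  set th : ℕ → ℝ := fun k => 2 * W * thresholds α k with hth
  set D : ℕ → Finset V := fun k => Finset.univ.filter fun v => h m - th k ≤ h v with hD
  have hthmono : Monotone th := fun i j hij =>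
    mul_le_mul_of_nonneg_left (thresholds_mono hα0 M.minProb_le_one hij) (by positivity)
  have hcard : ∀ k, k ≤ Fintype.card V → k + 1 ≤ (D k).card := by
    intro k
    induction k with
    | zero =>
      intro _
      exact Finset.card_pos.2 ⟨m, by simp [hD, hth, thresholds]⟩
    | succ k ih =>
      intro hk
      have hk' : th k < h m := (hthmono (by omega : k ≤ Fintype.card V)).trans_lt hmbig
      have hDpos : ∀ v ∈ D k, h m - th k ≤ h v := fun v hv => (Finset.mem_filter.1 hv).2
      have hDint : ∀ v ∈ D k,
          M.Internal g v (τ v) ∧ h v = M.w v - g v + (1 - lam) * M.nextVal h v (τ v) :=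
        fun v hv => hτ v (by linarith [hDpos v hv])
      obtain ⟨v, hv, u, hu, huD⟩ : ∃ v ∈ D k, ∃ u, 0 < M.θ v (τ v) u ∧ u ∉ D k := by
        by_contra! hcl
        refine hg.not_surplus (D := (D k : Set V)) (τ := τ) (h := h) (S := h m)
          (c := lam * (h m - th k)) ?_ (by nlinarith) h0 hm (fun v hv => (hDint v hv).1)
          (fun v hv u hu => hcl v hv u hu) fun v hv => ?_
        · exact_mod_cast Finset.card_pos.1 (by have := ih (by omega); omega)
        · have h1 := (hDint v hv).2
          have h2 : h m - th k ≤ M.nextVal h v (τ v) :=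
            M.le_nextVal fun u hu => hDpos u (hcl v hv u hu)
          nlinarith
      have huD' : u ∈ D (k + 1) := by
        refine Finset.mem_filter.2 ⟨Finset.mem_univ u, ?_⟩
        have h1 := (hDint v hv).2
        have h2 : M.nextVal h v (τ v) ≤ h m - M.θ v (τ v) u * (h m - h u) :=
          M.nextVal_le_sub hm u
        have h3 : 0 ≤ M.nextVal h v (τ v) := M.le_nextVal fun u _ => h0 u
        have h4 := mul_le_mul_of_nonneg_right (M.minProb_le hu) (sub_nonneg.2 (hm u))
        have h5 : α * (h m - h u) ≤ 2 * W + th k := by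
          nlinarith [hwg v, hDpos v hv]
        have h6 : h m - h u ≤ th (k + 1) := by
          have : th (k + 1) = (2 * W + th k) / α := by
            simp only [hth, thresholds]
            ring
          rw [this, le_div_iff₀ hα0]
          linarith
        linarith
      have hsub : D k ⊂ D (k + 1) := by
        refine (Finset.ssubset_iff_of_subset fun v hv => ?_).2 ⟨u, huD', huD⟩
        refine Finset.mem_filter.2 ⟨Finset.mem_univ v, ?_⟩
        linarith [hDpos v hv, hthmono (Nat.le_succ k)]
      have := Finset.card_lt_card hsub
      have := ih (by omega)
      omega
  have h1 := hcard _ le_rfl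
  have h2 := Finset.card_le_univ (D (Fintype.card V))
  omega

/-! ### Changes of level -/

/-- There is a bounded function of the level of `g` that decreases by one in expectation whenever
an action that is not internal is played: such an action lowers `g` with probability at least `α`,
and `g` has at most `card V` levels. -/
theorem IsGain.exists_level_potential [Nonempty A] {M : MDP V A} {g : V → ℝ} {s : V → A}
    (hg : M.IsGain g s) :
    ∃ N : V → ℝ, (∀ v, 0 ≤ N v) ∧ (∀ v, N v ≤ thresholds M.minProb (Fintype.card V)) ∧
      (∀ v a, M.Internal g v a → M.nextVal N v a = N v) ∧
      ∀ v a, ¬ M.Internal g v a → M.nextVal N v a ≤ N v - 1 := by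
  classical
  set α := M.minProb with hα
  have hα0 : 0 < α := M.minProb_pos
  have hmono := thresholds_mono hα0 M.minProb_le_one
  set n := Fintype.card V with hn
  set rank : V → ℕ := fun v => (Finset.univ.filter fun u => g u < g v).card with hrank
  have hrank_le : ∀ v, rank v ≤ n := fun v => Finset.card_le_univ _
  have hrank_eq : ∀ u v, g u = g v → rank u = rank v := fun u v h => by simp [hrank, h]
  have hrank_lt : ∀ u v, g u < g v → rank u < rank v := fun u v h => by
    refine Finset.card_lt_card ((Finset.ssubset_iff_of_subset fun x hx => ?_).2 ⟨u, ?_, ?_⟩)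
    · simp only [Finset.mem_filter, Finset.mem_univ, true_and] at hx ⊢
      exact hx.trans h
    · simpa using h
    · simp
  refine ⟨fun v => thresholds α n - thresholds α (n - rank v), fun v => ?_, fun v => ?_,
    fun v a ha => ?_, fun v a ha => ?_⟩
  · exact sub_nonneg.2 (hmono (Nat.sub_le _ _))
  · linarith [thresholds_nonneg hα0 (n - rank v)]
  · exact M.nextVal_eq fun u hu => by rw [hrank_eq u v (ha u hu)]
  · obtain ⟨u, hu, hgu⟩ : ∃ u, 0 < M.θ v a u ∧ g u < g v := by
      by_contra! hcon
      unfold Internal at ha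
      push Not at ha
      obtain ⟨u, hu, hne⟩ := ha
      have h1 : M.nextVal (fun x => -g x) v a ≤ -g v - M.θ v a u * (-g v - -g u) := by
        have h2 : M.nextVal (fun x => -g x) v a ≤
            M.nextVal (fun x => if x = u then -g x else -g v) v a :=
          M.nextVal_mono fun x hx => by
            split_ifs
            · exact le_rfl
            · linarith [hcon x hx]
        refine h2.trans ((M.nextVal_le_sub (m := -g v) (fun x => ?_) u).trans_eq (by simp))
        split_ifs with hxu
        · subst hxu
          linarith [hcon x hu]
        · exact le_rfl
      have h3 : M.nextVal (fun x => -g x) v a = -M.nextVal g v a := by simp [nextVal]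
      have h4 := hg.nextVal_le v a
      have h5 : 0 < g u - g v := sub_pos.2 (lt_of_le_of_ne (hcon u hu) (Ne.symm hne))
      nlinarith
    have h1 := M.nextVal_le_sub (v := v) (a := a)
      (F := fun v => thresholds α n - thresholds α (n - rank v)) (m := thresholds α n)
      (fun x => by linarith [thresholds_nonneg hα0 (n - rank x)]) u
    have h2 : thresholds α (n - rank v + 1) ≤ thresholds α (n - rank u) :=
      hmono (by have := hrank_lt u v hgu; have := hrank_le v; omega)
    have h3 : α * thresholds α (n - rank v + 1) = 1 + thresholds α (n - rank v) := by
      rw [thresholds]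
      field_simp
    have h4 : α * thresholds α (n - rank v + 1) ≤ M.θ v a u * thresholds α (n - rank u) :=
      mul_le_mul (M.minProb_le hu) h2 (thresholds_nonneg hα0 _) (M.θ_nonneg v a u)
    have h5 : thresholds α n - (thresholds α n - thresholds α (n - rank u)) =
        thresholds α (n - rank u) := by ring
    simp only [h5] at h1
    linarith

/-! ### The total reward -/

/-- If `H` decreases in expectation by at least `w - g - ε` and `g` does not increase in
expectation, then `H` bounds the total surplus over `g`. -/
theorem totalReward_le_of_potential (M : MDP V A) (σ : Strategy V A) (t : ℕ) {g H : V → ℝ}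
    {B ε : ℝ} (hg : ∀ v a, M.nextVal g v a ≤ g v) (hH0 : ∀ v, 0 ≤ H v) (hHB : ∀ v, H v ≤ B)
    (hH : ∀ v a, M.w v - g v + M.nextVal H v a ≤ H v + ε) :
    M.totalReward σ t ≤ B + (t + 1) * (∑ v, M.μ v * g v + ε) := by
  have hgi : ∀ i, M.expVal σ i g ≤ ∑ v, M.μ v * g v := by
    intro i
    induction i with
    | zero => rw [expVal_zero]
    | succ k ih => exact (M.expVal_succ_le σ k hg).trans ih
  have hstep : ∀ i, M.expectedWeight σ i ≤
      M.expVal σ i H - M.expVal σ (i + 1) H + (∑ v, M.μ v * g v + ε) := by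
    intro i
    have h1 : M.expVal σ (i + 1) H ≤
        M.expVal σ i (fun v => (H v - M.w v) + (g v + ε)) :=
      M.expVal_succ_le σ i fun v a => by linarith [hH v a]
    rw [expVal_add, expVal_sub, expVal_add, expVal_const] at h1
    have h2 : M.expectedWeight σ i = M.expVal σ i M.w := rfl
    linarith [hgi i]
  have hsum : ∀ k : ℕ, ∑ i ∈ Finset.range k, M.expectedWeight σ i ≤
      M.expVal σ 0 H - M.expVal σ k H + k * (∑ v, M.μ v * g v + ε) := by
    intro k
    induction k with
    | zero => simp
    | succ k ih =>
      rw [Finset.sum_range_succ]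
      push_cast
      linarith [hstep k]
  have h1 := hsum (t + 1)
  have h2 : M.expVal σ 0 H ≤ B := (M.expVal_mono σ 0 hHB).trans_eq (M.expVal_const σ 0 B)
  have h3 : 0 ≤ M.expVal σ (t + 1) H :=
    (M.expVal_const σ (t + 1) 0).symm.le.trans (M.expVal_mono σ (t + 1) hH0)
  push_cast at h1
  unfold totalReward
  linarith

theorem totalReward_le [Nonempty A] (M : MDP V A) (hM : M.optMeanPayoff ≤ 0)
    (σ : Strategy V A) (t : ℕ) :
    M.totalReward σ t ≤ 2 * M.maxWeight * (thresholds M.minProb (Fintype.card V) *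
      (3 + thresholds M.minProb (Fintype.card V))) := by
  obtain ⟨g, s, hg⟩ := M.exists_isGain
  -- With this discount factor the discounting error over `t + 1` steps is at most one potential.
  set lam : ℝ := 1 / ((t : ℝ) + 2) with hlam
  have hl0 : 0 < lam := by positivity
  have hl1 : lam < 1 := by
    rw [hlam, div_lt_one (by positivity)]
    linarith [(Nat.cast_nonneg t : (0 : ℝ) ≤ t)]
  obtain ⟨h, h0, hS, hint⟩ := hg.exists_internal_potential hl0 hl1
  obtain ⟨N, hN0, hN, hNint, hNext⟩ := hg.exists_level_potential
  set W := M.maxWeight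
  set T := thresholds M.minProb (Fintype.card V) with hT
  have hW0 : 0 ≤ W := M.maxWeight_nonneg
  have hT0 : 0 ≤ T := thresholds_nonneg M.minProb_pos _
  set K := 2 * W + 2 * W * T with hK
  have hK0 : 0 ≤ K := by positivity
  have hmain := M.totalReward_le_of_potential σ t (g := g) (H := fun v => h v + K * N v)
    (B := 2 * W * T + K * T) (ε := lam * (2 * W * T)) hg.nextVal_le
    (fun v => add_nonneg (h0 v) (mul_nonneg hK0 (hN0 v)))
    (fun v => add_le_add (hS v) (mul_le_mul_of_nonneg_left (hN v) hK0))
    (fun v a => by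
      have hSv : M.nextVal h v a ≤ 2 * W * T := M.nextVal_le fun u _ => hS u
      have hε : 0 ≤ lam * (2 * W * T) := by positivity
      rw [nextVal_add, nextVal_const_mul]
      by_cases ha : M.Internal g v a
      · have h1 := hint v a ha
        have h2 := mul_le_mul_of_nonneg_left hSv hl0.le
        rw [hNint v a ha]
        linarith
      · have h1 := mul_le_mul_of_nonneg_left (hNext v a ha) hK0
        have h2 := (_root_.abs_le.1 (M.abs_w_le v)).2
        have h3 := (_root_.abs_le.1 (hg.abs_le v)).1
        linarith [h0 v])
  have hμ := hg.sum_nonpos hM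
  have h1 : ((t : ℝ) + 1) * lam ≤ 1 := by
    rw [hlam, mul_one_div, div_le_one (by positivity)]
    linarith
  have h2 : ((t : ℝ) + 1) * lam * (2 * W * T) ≤ 1 * (2 * W * T) :=
    mul_le_mul_of_nonneg_right h1 (by positivity)
  have h3 : ((t : ℝ) + 1) * ∑ v, M.μ v * g v ≤ 0 :=
    mul_nonpos_of_nonneg_of_nonpos (by positivity) hμ
  rw [hK] at hmain
  linarith

end MDP

theorem mainTheorem5 :
    ∃ (C : ℝ) (c : ℕ), ∀ (V A : Type*) [Fintype V] [Fintype A] [Nonempty A] (M : MDP V A),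
      M.optMeanPayoff ≤ 0 →
        M.supTotalReward ≤
          ((C * (Fintype.card V : ℝ) ^ 16 * M.maxWeight *
            (1 / M.minProb) ^ (c * Fintype.card V ^ 3) : ℝ) : EReal) := by
  refine ⟨8, 2, fun V A _ _ _ M hM => iSup_le fun σ => iSup_le fun t => ?_⟩
  rw [EReal.coe_le_coe_iff]
  refine (M.totalReward_le hM σ t).trans ?_
  have hα0 := M.minProb_pos
  have hα1 := M.minProb_le_one
  have hW0 := M.maxWeight_nonneg
  have := M.nonempty_vertices
  set n := Fintype.card V with hn
  have hn1 : 1 ≤ n := Fintype.card_pos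
  have hn1' : (1 : ℝ) ≤ n := by exact_mod_cast hn1
  have hq : 1 ≤ 1 / M.minProb := by rwa [le_div_iff₀ hα0, one_mul]
  set q := 1 / M.minProb with hqdef
  set T := MDP.thresholds M.minProb n with hT
  have hT0 : 0 ≤ T := MDP.thresholds_nonneg hα0 n
  have hTle : T ≤ n * q ^ n := MDP.thresholds_le hα0 hα1 n
  have hnq : 1 ≤ n * q ^ n := one_le_mul_of_one_le_of_one_le hn1' (one_le_pow₀ hq)
  have h1 : T * (3 + T) ≤ 4 * (n * q ^ n) ^ 2 := by nlinarith
  have h2 : ((n : ℝ) * q ^ n) ^ 2 ≤ n ^ 16 * q ^ (2 * n ^ 3) := by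
    rw [mul_pow, ← pow_mul]
    have h3 : n * 2 ≤ 2 * n ^ 3 := by
      have := Nat.le_self_pow (n := 3) (by norm_num) n
      omega
    gcongr
    norm_num
  calc 2 * M.maxWeight * (T * (3 + T))
      ≤ 2 * M.maxWeight * (4 * (n ^ 16 * q ^ (2 * n ^ 3))) := by
        refine mul_le_mul_of_nonneg_left ?_ (by positivity)
        linarith
    _ = 8 * n ^ 16 * M.maxWeight * q ^ (2 * n ^ 3) := by ring
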